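/- There is an absolute constant $K \in \mathbb{N}$ such that the following holds for all integers $d \ge 1$, $\Delta \ge 2$ and $n \ge 0$. Let $T_1, \ldots, T_n$ be nonempty finite multisets of vectors in $\mathbb{Z}_{\ge 0}^d$ such that $\|t\|_\infty \le \Delta$ for every $t \in T_i$ and every $i$, and such that all total sums agree, $$\sum_{t \in T_1} t = \cdots = \sum_{t \in T_n} t .$$ Then there exist nonempty submultisets $S_1 \subseteq T_1, \ldots, S_n \subseteq T_n$ with $$|S_i| \le (d\Delta)^{K \cdot d \cdot \Delta^{d^2}} \qquad (1 \le i \le n)$$ and $$\sum_{s \in S_1} s = \cdots = \sum_{s \in S_n} s .$$ Here cardinalities, sums and inclusions of multisets count multiplicities. In particular the bound depends neither on $n$ nor on the common sum. -/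

import Mathlib

/-! Let b be the common sum. Consider all simplicial cones that contain b and are spanned by d
linearly independent vectors of the box [0,Δ]^d, and order vectors by their coordinates in all these
cones at once. The cones are boundedly many and cut out by bounded integer functionals, so b
dominates some μ r, where r is a bounded integer vector on an extreme ray of their intersection and
μ r carries a fixed share of the coordinate sum of b (`exists_int_vector_le`).

If μ is small, so is b, and each T_i without its zero vectors is already small. If μ is large, a
Carathéodory argument (`exists_linearIndepOn_support_le`) finds inside each T_i a fractional
combination of linearly independent vectors with sum t b, t ≥ 1/(Δ+1)^d. These vectors extend to a
basis spanning one of the cones, where the combination has t times the coordinates of b, hence at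
least M times those of r; here M = D! and D = d! Δ^d bounds all determinants. Since M r has integer
coordinates there, it is the sum of a submultiset of T_i (`exists_nat_combination`), and M r does
not depend on i. -/

open Finset

/-! ### Extreme rays of polyhedral cones -/

section Cone

variable {ι E : Type*} [AddCommGroup E] [Module ℚ E]

/-- A vector is elementary for the coordinate functions `a` if it is determined up to scaling
by the set of coordinates that vanish on it. -/
def IsElementary (a : E →ₗ[ℚ] (ι → ℚ)) (v : E) : Prop :=
  ∀ w, (∀ j, a v j = 0 → a w j = 0) → ∃ c : ℚ, w = c • v

lemma IsElementary.smul {a : E →ₗ[ℚ] (ι → ℚ)} {v : E} (hv : IsElementary a v) {c : ℚ}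
    (hc : c ≠ 0) : IsElementary a (c • v) := by
  intro w hw
  obtain ⟨e, he⟩ := hv w fun j hj => hw j (by simp [hj])
  exact ⟨e / c, by rw [he, smul_smul, div_mul_cancel₀ _ hc]⟩

variable [Fintype ι]

/-- Subtracting a suitable multiple of `w` from a nonnegative `y` keeps it nonnegative and kills
one more coordinate. -/
lemma exists_sub_smul_nonneg (a : E →ₗ[ℚ] (ι → ℚ)) {y w : E} (hy : ∀ j, 0 ≤ a y j)
    (hw : ∀ j, a y j = 0 → a w j = 0) (hpos : ∃ j, 0 < a w j) :
    ∃ θ : ℚ, 0 < θ ∧ (∀ j, 0 ≤ a (y - θ • w) j) ∧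
      (univ.filter fun j => a (y - θ • w) j ≠ 0) ⊂ univ.filter fun j => a y j ≠ 0 := by
  classical
  -- Ratio test of the simplex method: the minimal ratio is the largest admissible θ.
  obtain ⟨j₀, hj₀, hmin⟩ := exists_min_image (univ.filter fun j => 0 < a w j)
    (fun j => a y j / a w j) (by obtain ⟨j, hj⟩ := hpos; exact ⟨j, by simpa using hj⟩)
  simp only [mem_filter, mem_univ, true_and] at hj₀ hmin
  have hyj₀ : a y j₀ ≠ 0 := fun h => hj₀.ne' (hw _ h)
  have hθ : 0 < a y j₀ / a w j₀ := div_pos (lt_of_le_of_ne (hy _) hyj₀.symm) hj₀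
  refine ⟨a y j₀ / a w j₀, hθ, fun j => ?_, ?_⟩
  · simp only [map_sub, map_smul, Pi.sub_apply, Pi.smul_apply, smul_eq_mul, sub_nonneg]
    rcases lt_or_ge 0 (a w j) with h | h
    · exact (le_div_iff₀ h).1 (hmin j h)
    · exact (mul_nonpos_of_nonneg_of_nonpos hθ.le h).trans (hy j)
  · rw [ssubset_iff_of_subset]
    · refine ⟨j₀, by simpa using hyj₀, ?_⟩
      simp [div_mul_cancel₀ _ hj₀.ne']
    · intro j
      simp only [mem_filter, mem_univ, true_and]
      intro h h0
      exact h (by simp [h0, hw j h0])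

/-- Descent on the support: if y is not elementary, a non-proportional w supported in y can be
subtracted until a coordinate of y vanishes. -/
lemma exists_isElementary (a : E →ₗ[ℚ] (ι → ℚ)) (ha : Function.Injective a) {y : E}
    (hy : ∀ j, 0 ≤ a y j) (hy0 : y ≠ 0) :
    ∃ v, v ≠ 0 ∧ (∀ j, 0 ≤ a v j) ∧ (∀ j, a y j = 0 → a v j = 0) ∧ IsElementary a v := by
  classical
  induction hs : (univ.filter fun j => a y j ≠ 0) using Finset.strongInduction generalizing y with
  | H s ih =>
  subst hs
  by_cases hel : IsElementary a y
  · exact ⟨y, hy0, hy, fun _ h => h, hel⟩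
  have : ∃ w, (∀ j, a y j = 0 → a w j = 0) ∧ (∀ c : ℚ, w ≠ c • y) ∧ ∃ j, 0 < a w j := by
    unfold IsElementary at hel
    push Not at hel
    obtain ⟨w, hw, hne⟩ := hel
    by_cases hpos : ∃ j, 0 < a w j
    · exact ⟨w, hw, hne, hpos⟩
    push Not at hpos
    refine ⟨-w, fun j hj => by simp [hw j hj], fun c hc => hne (-c) ?_, ?_⟩
    · rw [neg_smul, ← hc, neg_neg]
    · by_contra! h
      refine hne 0 (ha ?_)
      ext j
      have := h j
      simp only [map_neg, Pi.neg_apply] at this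
      simp only [zero_smul, map_zero, Pi.zero_apply]
      linarith [hpos j]
  obtain ⟨w, hw, hne, hpos⟩ := this
  obtain ⟨θ, hθ, hnn, hss⟩ := exists_sub_smul_nonneg a hy hw hpos
  obtain ⟨v, hv0, hv, hsupp, hvel⟩ := ih _ hss hnn (fun h => hne θ⁻¹ (by
    rw [sub_eq_zero.1 h, smul_smul, inv_mul_cancel₀ hθ.ne', one_smul])) rfl
  exact ⟨v, hv0, hv, fun j hj => hsupp j (by simp [hj, hw j hj]), hvel⟩

/-- A nonnegative vector dominates an elementary vector carrying at least the average share
of any functional that is nonnegative on the cone. -/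
lemma exists_isElementary_le (a : E →ₗ[ℚ] (ι → ℚ)) (ha : Function.Injective a)
    (φ : E →ₗ[ℚ] ℚ) (hφ : ∀ x, (∀ j, 0 ≤ a x j) → 0 ≤ φ x) {y : E} (hy : ∀ j, 0 ≤ a y j) :
    ∃ v, (∀ j, 0 ≤ a v j) ∧ (∀ j, a v j ≤ a y j) ∧ IsElementary a v ∧
      φ y ≤ Fintype.card ι * φ v := by
  classical
  -- Counting only nonzero coordinates lets the induction gain 1 with each ray removed.
  suffices h : ∃ v, (∀ j, 0 ≤ a v j) ∧ (∀ j, a v j ≤ a y j) ∧ IsElementary a v ∧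
      φ y ≤ #(univ.filter fun j => a y j ≠ 0) * φ v by
    obtain ⟨v, h1, h2, h3, h4⟩ := h
    refine ⟨v, h1, h2, h3, h4.trans ?_⟩
    gcongr
    · exact hφ v h1
    · exact card_le_univ _
  induction hs : (univ.filter fun j => a y j ≠ 0) using Finset.strongInduction generalizing y with
  | H s ih =>
  subst hs
  by_cases hy0 : y = 0
  · subst hy0
    refine ⟨0, by simp, by simp, fun w hw => ⟨0, ha ?_⟩, by simp⟩
    ext j
    simpa using hw j
  obtain ⟨v, hv0, hv, hsupp, hel⟩ := exists_isElementary a ha hy hy0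
  have hpos : ∃ j, 0 < a v j := by
    by_contra! h
    refine hv0 (ha ?_)
    ext j
    simpa using le_antisymm (h j) (hv j)
  obtain ⟨θ, hθ, hnn, hss⟩ := exists_sub_smul_nonneg a hy hsupp hpos
  obtain ⟨v', h1, h2, h3, h4⟩ := ih _ hss hnn rfl
  have hcard := card_lt_card hss
  have hsum : φ y = φ (θ • v) + φ (y - θ • v) := by rw [← map_add]; simp
  have hv' := hφ v' h1
  have hcard' : ((#(univ.filter fun j => a (y - θ • v) j ≠ 0) : ℕ) : ℚ) + 1 ≤
      #(univ.filter fun j => a y j ≠ 0) := by exact_mod_cast hcard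
  set N : ℚ := ((#(univ.filter fun j => a y j ≠ 0) : ℕ) : ℚ)
  set N' : ℚ := ((#(univ.filter fun j => a (y - θ • v) j ≠ 0) : ℕ) : ℚ)
  have hN' : 0 ≤ N' := Nat.cast_nonneg _
  have hθv : ∀ j, 0 ≤ a (θ • v) j := fun j => by
    simpa using mul_nonneg hθ.le (hv j)
  -- The larger of the ray just removed and the inductive one carries the average share.
  rcases le_total (φ (θ • v)) (φ v') with h | h
  · refine ⟨v', h1, fun j => (h2 j).trans ?_, h3, ?_⟩
    · have := hθv j
      rw [map_sub, Pi.sub_apply]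
      linarith
    · nlinarith
  · refine ⟨θ • v, hθv, fun j => ?_, hel.smul hθ.ne', ?_⟩
    · have := hnn j
      rw [map_sub, Pi.sub_apply] at this
      linarith
    · have := hφ _ hθv
      nlinarith

end Cone

/-! ### Basis extension and Cramer's rule -/

section Extend

/-- A linearly independent subfamily of a spanning family of `K^d` extends to a basis with
members in the family, indexed by `Fin d`. -/
lemma exists_linearIndependent_comp {K ι : Type*} [Field K] {d : ℕ} (u : ι → Fin d → K)
    (hu : Submodule.span K (Set.range u) = ⊤) {s : Set ι} (hs : LinearIndepOn K u s) :
    ∃ g : Fin d → ι, LinearIndependent K (u ∘ g) ∧ s ⊆ Set.range g := by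
  obtain ⟨t, -, hst, hspan, hli⟩ := exists_linearIndepOn_extension hs (Set.subset_univ s)
  have htop : ⊤ ≤ Submodule.span K (Set.range fun i : t => u i) := by
    rw [← hu, Submodule.span_le, ← Set.image_univ]
    refine hspan.trans_eq ?_
    rw [Set.image_eq_range]
  let e := (Module.Basis.mk hli htop).indexEquiv (Pi.basisFun K (Fin d))
  refine ⟨fun i => (e.symm i : ι), hli.comp _ e.symm.injective, fun i hi => ?_⟩
  exact ⟨e ⟨i, hst hi⟩, by simp⟩

open Matrix

lemma abs_adjugate_le {d : ℕ} (A : Matrix (Fin d) (Fin d) ℤ) {E : ℕ} (hE : 1 ≤ E)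
    (hA : ∀ i j, |A i j| ≤ E) (i j : Fin d) : |A.adjugate i j| ≤ (d.factorial * E ^ d : ℕ) := by
  rw [adjugate_apply]
  have := Matrix.det_le (A := A.updateRow j (Pi.single i 1)) (abv := AbsoluteValue.abs)
    (x := (E : ℤ)) (fun k l => by
      rw [AbsoluteValue.abs_apply, updateRow_apply]
      split_ifs
      · rw [Pi.single_apply]
        split_ifs <;> simp
        exact_mod_cast hE
      · exact hA k l)
  simpa using this

lemma abs_det_le {d : ℕ} (A : Matrix (Fin d) (Fin d) ℤ) {E : ℕ}
    (hA : ∀ i j, |A i j| ≤ E) : |A.det| ≤ (d.factorial * E ^ d : ℕ) := by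
  have := Matrix.det_le (A := A) (abv := AbsoluteValue.abs) (x := (E : ℤ)) hA
  simpa using this

/-- A vector determined up to scaling by the integer functionals vanishing on it is proportional to
a bounded integer vector. -/
lemma exists_int_smul {κ : Type*} {d E : ℕ} (hE : 1 ≤ E) (u : κ → Fin d → ℤ)
    (hu : ∀ j k, |u j k| ≤ E) (hunit : ∀ k, ∃ j, u j = Pi.single k 1) (r₀ : Fin d → ℚ)
    (h0 : r₀ ≠ 0)
    (hel : ∀ w : Fin d → ℚ, (∀ j, (fun k => (u j k : ℚ)) ⬝ᵥ r₀ = 0 →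
      (fun k => (u j k : ℚ)) ⬝ᵥ w = 0) → ∃ c : ℚ, w = c • r₀) :
    ∃ (r : Fin d → ℤ) (c : ℚ), (∀ k, |r k| ≤ (d.factorial * E ^ d : ℕ)) ∧
      r₀ = c • fun k => (r k : ℚ) := by
  classical
  set v : κ → Fin d → ℚ := fun j k => (u j k : ℚ) with hv
  have hspan : Submodule.span ℚ (Set.range v) = ⊤ := by
    rw [eq_top_iff, ← (Pi.basisFun ℚ (Fin d)).span_eq]
    refine Submodule.span_mono ?_
    rintro _ ⟨k, rfl⟩
    obtain ⟨j, hj⟩ := hunit k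
    refine ⟨j, ?_⟩
    ext l
    simp [hv, hj, Pi.single_apply]
  obtain ⟨s, hst, -, hts, hs⟩ := exists_linearIndepOn_extension (K := ℚ) (v := v) (s := ∅)
    (t := {j | v j ⬝ᵥ r₀ = 0}) (linearIndepOn_empty _ _) (Set.empty_subset _)
  obtain ⟨g, hg, hsg⟩ := exists_linearIndependent_comp v hspan hs
  let G : Matrix (Fin d) (Fin d) ℤ := of fun i k => u (g i) k
  let GQ : Matrix (Fin d) (Fin d) ℚ := G.map (Int.cast)
  have hGQ : IsUnit GQ := by
    rw [← linearIndependent_rows_iff_isUnit]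
    exact hg
  have hdetQ : GQ.det = (G.det : ℚ) := by
    simpa using (RingHom.map_det (Int.castRingHom ℚ) G).symm
  have hdet : (G.det : ℚ) ≠ 0 := by
    rw [← hdetQ]
    exact ((isUnit_iff_isUnit_det _).1 hGQ).ne_zero
  obtain ⟨i, hi⟩ : ∃ i, v (g i) ⬝ᵥ r₀ ≠ 0 := by
    by_contra! h
    refine h0 ((mulVec_injective_iff_isUnit.2 hGQ) ?_)
    rw [mulVec_zero]
    ext i
    exact h i
  -- This adjugate column is killed by every row but i. Row i is not in s, and s spans the
  -- functionals vanishing on r₀, so these all vanish on r too.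
  let r : Fin d → ℤ := fun k => G.adjugate k i
  have hGr : ∀ l, v (g l) ⬝ᵥ (fun k => (r k : ℚ)) = if l = i then (G.det : ℚ) else 0 := by
    intro l
    have := congrFun (congrFun (mul_adjugate G) l) i
    rw [mul_apply, Matrix.smul_apply, one_apply] at this
    have h2 := congrArg (Int.cast : ℤ → ℚ) this
    push_cast at h2
    rw [dotProduct]
    simp only [smul_eq_mul, Int.cast_ite, Int.cast_zero, mul_ite,
      mul_one, mul_zero] at h2
    exact h2
  obtain ⟨c, hc⟩ := hel (fun k => (r k : ℚ)) (by
    intro j hj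
    have hmem : v j ∈ Submodule.span ℚ (v '' s) := hts ⟨j, hj, rfl⟩
    refine Submodule.span_induction (p := fun x _ => x ⬝ᵥ (fun k => (r k : ℚ)) = 0)
      ?_ (by simp) (fun x y _ _ hx hy => by simp [add_dotProduct, hx, hy])
      (fun e x _ hx => by simp [smul_dotProduct, hx]) hmem
    rintro _ ⟨j', hj', rfl⟩
    obtain ⟨l, rfl⟩ := hsg hj'
    rw [hGr, if_neg]
    rintro rfl
    exact hi (hst hj'))
  have hc0 : c ≠ 0 := by
    rintro rfl
    have := hGr i
    rw [hc] at this
    simp at this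
    exact hdet (by exact_mod_cast this.symm)
  refine ⟨r, c⁻¹, fun k => abs_adjugate_le G hE (fun _ _ => hu _ _) k i, ?_⟩
  rw [hc, smul_smul, inv_mul_cancel₀ hc0, one_smul]

end Extend

/-! ### Bounded integer rays and integral combinations -/

section Bounded

open Matrix

/-- A nonzero rational vector in a cone cut out by bounded integer functionals dominates a
large multiple of a bounded integer vector of the cone. -/
lemma exists_int_vector_le {κ : Type*} [Fintype κ] {d E : ℕ} (hE : 1 ≤ E) (u : κ → Fin d → ℤ)
    (hu : ∀ j k, |u j k| ≤ E) (hunit : ∀ k, ∃ j, u j = Pi.single k 1) (b : Fin d → ℚ)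
    (h0 : b ≠ 0) (hb : ∀ j, 0 ≤ (fun k => (u j k : ℚ)) ⬝ᵥ b) :
    ∃ (r : Fin d → ℤ) (μ : ℚ), 0 < μ ∧ r ≠ 0 ∧ (∀ k, 0 ≤ r k) ∧
      (∀ k, r k ≤ (d.factorial * E ^ d : ℕ)) ∧
      (∀ j, 0 ≤ (fun k => (u j k : ℚ)) ⬝ᵥ fun k => (r k : ℚ)) ∧
      (∀ j, μ * ((fun k => (u j k : ℚ)) ⬝ᵥ fun k => (r k : ℚ)) ≤ (fun k => (u j k : ℚ)) ⬝ᵥ b) ∧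
      ∑ k, b k ≤ Fintype.card κ * (μ * ∑ k, (r k : ℚ)) := by
  let U : Matrix κ (Fin d) ℚ := of fun j k => (u j k : ℚ)
  have hUunit : ∀ k, ∃ j, ∀ x : Fin d → ℚ, U.mulVecLin x j = x k := by
    intro k
    obtain ⟨j, hj⟩ := hunit k
    refine ⟨j, fun x => ?_⟩
    simp only [mulVecLin_apply, mulVec, U, of_apply, hj, dotProduct]
    simp [Pi.single_apply]
  have hinj : Function.Injective U.mulVecLin := by
    intro x y hxy
    ext k
    obtain ⟨j, hj⟩ := hUunit k
    rw [← hj x, ← hj y, hxy]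
  have hnn : ∀ x : Fin d → ℚ, (∀ j, 0 ≤ U.mulVecLin x j) → ∀ k, 0 ≤ x k := by
    intro x hx k
    obtain ⟨j, hj⟩ := hUunit k
    rw [← hj x]
    exact hx j
  let φ : (Fin d → ℚ) →ₗ[ℚ] ℚ := ∑ k, LinearMap.proj k
  have hφ : ∀ x, φ x = ∑ k, x k := fun x => by simp [φ]
  obtain ⟨r₀, h1, h2, hel, h4⟩ := exists_isElementary_le U.mulVecLin hinj φ
    (fun x hx => by rw [hφ]; exact sum_nonneg fun k _ => hnn x hx k) (y := b) hb
  rw [hφ, hφ] at h4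
  have hr₀ : r₀ ≠ 0 := by
    rintro rfl
    simp only [Pi.zero_apply, sum_const_zero, mul_zero] at h4
    refine h0 (funext fun k => ?_)
    exact (sum_eq_zero_iff_of_nonneg fun k _ => hnn b hb k).1
      (le_antisymm h4 (sum_nonneg fun k _ => hnn b hb k)) k (mem_univ k)
  obtain ⟨r, c, hr, hc⟩ := exists_int_smul hE u hu hunit r₀ hr₀ hel
  have hc0 : c ≠ 0 := by
    rintro rfl
    exact hr₀ (by rw [hc, zero_smul])
  have key : ∃ (r' : Fin d → ℤ) (μ : ℚ), 0 < μ ∧ (∀ k, |r' k| ≤ (d.factorial * E ^ d : ℕ)) ∧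
      r₀ = μ • fun k => (r' k : ℚ) := by
    rcases lt_or_gt_of_ne hc0 with h | h
    · refine ⟨-r, -c, by linarith, by simpa using hr, ?_⟩
      rw [hc]
      ext k
      simp
    · exact ⟨r, c, h, hr, hc⟩
  obtain ⟨r', μ, hμ, hr', rfl⟩ := key
  have hU : ∀ j, U.mulVecLin (μ • fun k => (r' k : ℚ)) j =
      μ * ((fun k => (u j k : ℚ)) ⬝ᵥ fun k => (r' k : ℚ)) := by
    intro j
    rw [map_smul]
    rfl
  refine ⟨r', μ, hμ, ?_, fun k => ?_, fun k => (le_abs_self _).trans (hr' k), fun j => ?_,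
    fun j => ?_, ?_⟩
  · rintro rfl
    exact hr₀ (by ext k; simp)
  · have := hnn _ h1 k
    simp only [Pi.smul_apply, smul_eq_mul] at this
    exact_mod_cast (mul_nonneg_iff_of_pos_left hμ).1 this
  · have := h1 j
    rw [hU] at this
    exact (mul_nonneg_iff_of_pos_left hμ).1 this
  · rw [← hU]
    exact h2 j
  · simpa [mul_sum] using h4

/-- A nonnegative combination of nonnegative vectors dominates a combination with linearly
independent support that represents a large multiple of the same vector. -/
lemma exists_linearIndepOn_support_le {P : Type*} [Fintype P] {d : ℕ} (f : P → Fin d → ℚ)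
    (hf : ∀ p k, 0 ≤ f p k) (l : P → ℚ) (hl : ∀ p, 0 ≤ l p) {b : Fin d → ℚ}
    (hb : ∑ p, l p • f p = b) (h0 : b ≠ 0) :
    ∃ (x : P → ℚ) (t : ℚ), (∀ p, 0 ≤ x p) ∧ (∀ p, x p ≤ l p) ∧ 0 < t ∧ 1 ≤ Fintype.card P * t ∧
      ∑ p, x p • f p = t • b ∧ LinearIndepOn ℚ f {p | x p ≠ 0} := by
  classical
  let A : (P → ℚ) →ₗ[ℚ] (Fin d → ℚ) := Fintype.linearCombination ℚ f
  have hA : ∀ x, A x = ∑ p, x p • f p := fun x => by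
    simp [A, Fintype.linearCombination_apply]
  -- Elementary vectors of V with Aw ≠ 0 have independent support: a relation on the support also
  -- lies in V, so it is a multiple of x, hence zero.
  let V : Submodule ℚ (P → ℚ) := (Submodule.span ℚ {b}).comap A
  let ψ : (Fin d → ℚ) →ₗ[ℚ] ℚ := ∑ k, LinearMap.proj k
  have hψ : ∀ x, ψ x = ∑ k, x k := fun x => by simp [ψ]
  have hAnn : ∀ x : P → ℚ, (∀ p, 0 ≤ x p) → ∀ k, 0 ≤ A x k := by
    intro x hx k
    rw [hA, Finset.sum_apply]
    exact sum_nonneg fun p _ => mul_nonneg (hx p) (hf p k)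
  have hbnn : ∀ k, 0 ≤ b k := fun k => by rw [← hb, ← hA]; exact hAnn l hl k
  have hψb : 0 < ψ b := by
    rw [hψ]
    refine lt_of_le_of_ne (sum_nonneg fun k _ => hbnn k) fun h => h0 (funext fun k => ?_)
    exact (sum_eq_zero_iff_of_nonneg fun k _ => hbnn k).1 h.symm k (mem_univ k)
  obtain ⟨⟨x, hxV⟩, h1, h2, hel, h4⟩ := exists_isElementary_le V.subtype
    (Submodule.subtype_injective V) (ψ ∘ₗ A ∘ₗ V.subtype)
    (fun x hx => by
      simp only [LinearMap.comp_apply, hψ]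
      exact sum_nonneg fun k _ => hAnn _ hx k)
    (y := ⟨l, by
      simp only [V, Submodule.mem_comap, hA, hb]
      exact Submodule.mem_span_singleton_self b⟩) hl
  obtain ⟨t, ht⟩ := Submodule.mem_span_singleton.1 (Submodule.mem_comap.1 hxV)
  simp only [LinearMap.comp_apply, Submodule.subtype_apply, ← ht, hA l, hb, map_smul,
    smul_eq_mul] at h4
  have hct : 1 ≤ Fintype.card P * t := by
    rw [← mul_assoc] at h4
    exact le_of_mul_le_mul_right (by linarith) hψb
  have ht0 : 0 < t := by
    by_contra! h
    have : (Fintype.card P : ℚ) * t ≤ 0 := mul_nonpos_of_nonneg_of_nonpos (Nat.cast_nonneg _) h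
    linarith
  refine ⟨x, t, h1, h2, ht0, hct, by rw [ht, hA], ?_⟩
  rw [linearIndepOn_iff]
  intro w hw hw0
  rw [Finsupp.mem_supported] at hw
  have hAw : A w = 0 := by
    rw [hA, ← hw0, Finsupp.linearCombination_apply, Finsupp.sum_fintype _ _ (by simp)]
  have hwV : (w : P → ℚ) ∈ V := by
    rw [Submodule.mem_comap, hAw]
    exact zero_mem _
  obtain ⟨c, hc⟩ := hel ⟨w, hwV⟩ (fun p hp => by
    by_contra h
    exact hw (Finsupp.mem_support_iff.2 h) hp)
  have hc' : (w : P → ℚ) = c • x := congrArg Subtype.val hc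
  have hc0 : c = 0 := by
    rw [hc', map_smul, ← ht, smul_smul] at hAw
    rcases smul_eq_zero.1 hAw with h | h
    · exact (mul_eq_zero.1 h).resolve_right ht0.ne'
    · exact absurd h h0
  ext p
  rw [hc', hc0]
  simp

/-- The inverse of an integer matrix scaled by the square of its determinant. -/
def scaledInverse {d : ℕ} (A : Matrix (Fin d) (Fin d) ℤ) : Matrix (Fin d) (Fin d) ℤ :=
  A.det • A.adjugate

lemma abs_scaledInverse_le {d Δ : ℕ} (hΔ : 1 ≤ Δ) (A : Matrix (Fin d) (Fin d) ℤ)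
    (hA : ∀ i j, |A i j| ≤ Δ) (i j : Fin d) :
    |scaledInverse A i j| ≤ ((d.factorial * Δ ^ d) ^ 2 : ℕ) := by
  rw [scaledInverse, Matrix.smul_apply, smul_eq_mul, abs_mul, sq]
  push_cast
  have h1 := abs_det_le A hA
  have h2 := abs_adjugate_le A hΔ hA i j
  push_cast at h1 h2
  exact mul_le_mul h1 h2 (abs_nonneg _) (by positivity)

/-- The squared determinant makes each row a positive multiple of a coordinate functional, whatever
the sign of the determinant. -/
lemma scaledInverse_mulVec {d : ℕ} (A : Matrix (Fin d) (Fin d) ℤ) (y : Fin d → ℚ) (k : Fin d) :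
    (fun j => (scaledInverse A k j : ℚ)) ⬝ᵥ (A.map (Int.cast : ℤ → ℚ) *ᵥ y) =
      (A.det : ℚ) ^ 2 * y k := by
  have h : (scaledInverse A).map (Int.castRingHom ℚ) * A.map (Int.castRingHom ℚ) =
      ((A.det : ℚ) ^ 2) • (1 : Matrix (Fin d) (Fin d) ℚ) := by
    rw [← Matrix.map_mul, scaledInverse, smul_mul, adjugate_mul, smul_smul]
    ext i j
    simp only [Matrix.map_apply, Matrix.smul_apply, one_apply, smul_eq_mul, map_mul, eq_intCast,
      sq]
    split_ifs <;> simp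
  have h2 : (scaledInverse A).map (Int.castRingHom ℚ) *ᵥ (A.map (Int.castRingHom ℚ) *ᵥ y) =
      ((A.det : ℚ) ^ 2) • y := by
    rw [mulVec_mulVec, h, smul_mulVec, one_mulVec]
  exact congrFun h2 k

/-- If a multiple of the integer vector `r` is dominated, in the coordinates given by the columns
of `A`, by `y`, then `M • r` is an integral combination of the columns bounded by `y`. -/
lemma exists_nat_combination {d M : ℕ} (A : Matrix (Fin d) (Fin d) ℤ) (hdet : A.det ≠ 0)
    (hM : A.det ∣ M) (r : Fin d → ℤ) (b y : Fin d → ℚ) {μ t : ℚ} (ht : 0 < t)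
    (hr : ∀ k, 0 ≤ (fun j => (scaledInverse A k j : ℚ)) ⬝ᵥ fun j => (r j : ℚ))
    (hrb : ∀ k, μ * ((fun j => (scaledInverse A k j : ℚ)) ⬝ᵥ fun j => (r j : ℚ)) ≤
      (fun j => (scaledInverse A k j : ℚ)) ⬝ᵥ b)
    (hy : A.map (Int.cast : ℤ → ℚ) *ᵥ y = t • b) (hMt : (M : ℚ) ≤ t * μ) :
    ∃ z : Fin d → ℕ, (∀ k, (z k : ℚ) ≤ y k) ∧ A *ᵥ (fun k => (z k : ℤ)) = (M : ℤ) • r := by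
  obtain ⟨e, he⟩ := hM
  -- As M = e det A, this is M A⁻¹ r.
  let w : Fin d → ℤ := e • (A.adjugate *ᵥ r)
  have hdet2 : (0 : ℚ) < (A.det : ℚ) ^ 2 := by positivity
  have hw : ∀ k, (A.det : ℚ) ^ 2 * (w k : ℚ) =
      M * ((fun j => (scaledInverse A k j : ℚ)) ⬝ᵥ fun j => (r j : ℚ)) := by
    intro k
    have : (fun j => (scaledInverse A k j : ℚ)) ⬝ᵥ (fun j => (r j : ℚ)) =
        (A.det : ℚ) * ((A.adjugate *ᵥ r) k : ℤ) := by
      simp [scaledInverse, mulVec, dotProduct, mul_sum, mul_assoc]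
    rw [this]
    have hM' : (M : ℚ) = A.det * e := by exact_mod_cast he
    simp only [w, Pi.smul_apply, smul_eq_mul, Int.cast_mul, hM']
    ring
  have hw0 : ∀ k, 0 ≤ w k := by
    intro k
    have := hw k ▸ mul_nonneg (Nat.cast_nonneg (α := ℚ) M) (hr k)
    exact_mod_cast (mul_nonneg_iff_of_pos_left hdet2).1 this
  have hwy : ∀ k, (w k : ℚ) ≤ y k := by
    intro k
    refine le_of_mul_le_mul_left ?_ hdet2
    rw [hw, ← scaledInverse_mulVec, hy, dotProduct_smul, smul_eq_mul]
    calc _ ≤ t * μ * ((fun j => (scaledInverse A k j : ℚ)) ⬝ᵥ fun j => (r j : ℚ)) :=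
          mul_le_mul_of_nonneg_right hMt (hr k)
      _ ≤ _ := by rw [mul_assoc]; exact mul_le_mul_of_nonneg_left (hrb k) ht.le
  refine ⟨fun k => (w k).toNat, fun k => ?_, ?_⟩
  · refine le_trans (le_of_eq ?_) (hwy k)
    exact_mod_cast Int.toNat_of_nonneg (hw0 k)
  · have : (fun k => (((w k).toNat : ℕ) : ℤ)) = w := funext fun k => Int.toNat_of_nonneg (hw0 k)
    rw [this, mulVec_smul, mulVec_mulVec, mul_adjugate, smul_mulVec, one_mulVec, smul_smul, he,
      mul_comm]

end Bounded

/-! ### Cones spanned by box vectors -/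

section Box

open Matrix

/-- The vector of natural numbers underlying a point of the box. -/
def boxPoint {d Δ : ℕ} (p : Fin d → Fin (Δ + 1)) : Fin d → ℕ := fun j => p j

/-- The integer matrix whose columns are the given points of the box. -/
def columnMatrix {d Δ : ℕ} (C : Fin d → Fin d → Fin (Δ + 1)) : Matrix (Fin d) (Fin d) ℤ :=
  of fun j k => (boxPoint (C k) j : ℤ)

lemma abs_columnMatrix_le {d Δ : ℕ} (C : Fin d → Fin d → Fin (Δ + 1)) (i j : Fin d) :
    |columnMatrix C i j| ≤ Δ := by
  have := (C j i).is_le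
  simp only [columnMatrix, of_apply, boxPoint, Nat.abs_cast]
  exact_mod_cast this

lemma exists_columnMatrix_eq_one (d : ℕ) {Δ : ℕ} (hΔ : 1 ≤ Δ) :
    ∃ C : Fin d → Fin d → Fin (Δ + 1), columnMatrix C = 1 := by
  refine ⟨fun k j => if j = k then ⟨1, by omega⟩ else 0, ?_⟩
  ext i j
  simp only [columnMatrix, of_apply, boxPoint, one_apply]
  split_ifs <;> simp

lemma card_le_sum_coordinates {d : ℕ} (S : Multiset (Fin d → ℕ)) (hS : ∀ t ∈ S, t ≠ 0) :
    Multiset.card S ≤ ∑ k, S.sum k := by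
  induction S using Multiset.induction with
  | empty => simp
  | cons t S ih =>
    have h1 := ih fun s hs => hS s (Multiset.mem_cons_of_mem hs)
    have h2 : 1 ≤ ∑ k, t k := by
      by_contra! h
      refine hS t (Multiset.mem_cons_self t S) (funext fun k => ?_)
      exact (sum_eq_zero_iff.1 (Nat.lt_one_iff.1 h)) k (mem_univ k)
    rw [Multiset.card_cons, Multiset.sum_cons]
    simp only [Pi.add_apply, sum_add_distrib]
    omega

lemma sum_map_eq_sum_count {P M : Type*} [Fintype P] [DecidableEq P] [AddCommMonoid M]
    (T : Multiset P) (f : P → M) : (T.map f).sum = ∑ p, T.count p • f p := by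
  rw [Finset.sum_multiset_map_count]
  refine sum_subset (subset_univ _) fun p _ hp => ?_
  rw [Multiset.count_eq_zero.2 (by simpa using hp), zero_smul]

/-- The bound on the size of the submultisets. -/
def cardBound (d Δ : ℕ) : ℕ :=
  -- Number of functionals, times the threshold for μ, times the maximal coordinate sum of r.
  ((Δ + 1) ^ d) ^ d * d * ((d.factorial * Δ ^ d).factorial * (Δ + 1) ^ d) *
    (d * (d.factorial * ((d.factorial * Δ ^ d) ^ 2) ^ d))

/-- Every multiset of box points with sum `b` contains a small nonempty submultiset with the
prescribed sum, provided the prescribed vector lies deep enough in all simplicial cones. -/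
lemma exists_submultiset_sum_eq {d Δ M : ℕ} (T : Multiset (Fin d → Fin (Δ + 1))) (b : Fin d → ℕ)
    (h0 : b ≠ 0) (hT : (T.map boxPoint).sum = b)
    (hM : ∀ C : Fin d → Fin d → Fin (Δ + 1), (columnMatrix C).det ≠ 0 → (columnMatrix C).det ∣ M)
    (hunit : Submodule.span ℚ (Set.range fun (p : Fin d → Fin (Δ + 1)) k =>
      (boxPoint p k : ℚ)) = ⊤)
    (r : Fin d → ℤ) {μ : ℚ} (hμ : (M : ℚ) * Fintype.card (Fin d → Fin (Δ + 1)) ≤ μ)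
    (hr : ∀ C : Fin d → Fin d → Fin (Δ + 1), (columnMatrix C).det ≠ 0 →
      (∀ k, 0 ≤ (fun j => (scaledInverse (columnMatrix C) k j : ℚ)) ⬝ᵥ fun j => (b j : ℚ)) →
      ∀ k, 0 ≤ (fun j => (scaledInverse (columnMatrix C) k j : ℚ)) ⬝ᵥ (fun j => (r j : ℚ)) ∧
        μ * ((fun j => (scaledInverse (columnMatrix C) k j : ℚ)) ⬝ᵥ fun j => (r j : ℚ)) ≤
          (fun j => (scaledInverse (columnMatrix C) k j : ℚ)) ⬝ᵥ fun j => (b j : ℚ)) :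
    ∃ S ≤ T, (∀ p ∈ S, boxPoint p ≠ 0) ∧
      ∀ k, (((S.map boxPoint).sum k : ℕ) : ℤ) = M * r k := by
  classical
  set f : (Fin d → Fin (Δ + 1)) → Fin d → ℚ := fun p k => (boxPoint p k : ℚ) with hf
  have hb : ∑ p, ((T.count p : ℕ) : ℚ) • f p = fun j => (b j : ℚ) := by
    rw [sum_map_eq_sum_count] at hT
    ext j
    rw [← hT]
    simp [hf, Finset.sum_apply]
  obtain ⟨x, t, hx, hxl, ht, hct, hxb, hli⟩ := exists_linearIndepOn_support_le f
    (fun p k => Nat.cast_nonneg _) (fun p => ((T.count p : ℕ) : ℚ)) (fun p => Nat.cast_nonneg _) hb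
    (by
      intro h
      refine h0 (funext fun j => ?_)
      exact Nat.cast_eq_zero.1 (congrFun h j))
  obtain ⟨C, hC, hsupp⟩ := exists_linearIndependent_comp f hunit hli
  have hCinj : Function.Injective C := Function.Injective.of_comp hC.injective
  set A := columnMatrix C with hA
  have hdet : A.det ≠ 0 := by
    have h1 : IsUnit (A.map (Int.castRingHom ℚ)) := by
      rw [← linearIndependent_cols_iff_isUnit]
      exact hC
    have h2 := ((isUnit_iff_isUnit_det _).1 h1).ne_zero
    intro h
    refine h2 ?_
    rw [← RingHom.mapMatrix_apply, ← RingHom.map_det, h, map_zero]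
  have hAy : A.map (Int.cast : ℤ → ℚ) *ᵥ (fun k => x (C k)) = t • fun j => (b j : ℚ) := by
    rw [← hxb]
    ext j
    rw [Finset.sum_apply, mulVec, dotProduct]
    rw [← sum_subset (subset_univ (univ.image C)), sum_image fun _ _ _ _ h => hCinj h]
    · refine sum_congr rfl fun k _ => ?_
      simp [A, columnMatrix, hf, mul_comm]
    · intro p _ hp
      have : x p = 0 := by
        by_contra h
        obtain ⟨k, rfl⟩ := hsupp h
        exact hp (mem_image_of_mem _ (mem_univ _))
      simp [this]
  have hCb : ∀ k, 0 ≤ (fun j => (scaledInverse A k j : ℚ)) ⬝ᵥ fun j => (b j : ℚ) := by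
    intro k
    have := scaledInverse_mulVec A (fun k => x (C k)) k
    rw [hAy, dotProduct_smul, smul_eq_mul] at this
    exact (mul_nonneg_iff_of_pos_left ht).1 (this ▸ mul_nonneg (sq_nonneg _) (hx _))
  have hMt : (M : ℚ) ≤ t * μ := by
    calc (M : ℚ) ≤ M * (Fintype.card (Fin d → Fin (Δ + 1)) * t) :=
          le_mul_of_one_le_right (Nat.cast_nonneg _) hct
      _ = t * (M * Fintype.card (Fin d → Fin (Δ + 1))) := by ring
      _ ≤ t * μ := mul_le_mul_of_nonneg_left hμ ht.le
  obtain ⟨z, hz, hAz⟩ := exists_nat_combination A hdet (hM C hdet) r (fun j => (b j : ℚ))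
    (fun k => x (C k)) ht (fun k => (hr C hdet hCb k).1) (fun k => (hr C hdet hCb k).2) hAy hMt
  refine ⟨∑ k, Multiset.replicate (z k) (C k), ?_, ?_, ?_⟩
  · rw [Multiset.le_iff_count]
    intro p
    rw [Multiset.count_sum']
    simp only [Multiset.count_replicate]
    by_cases hp : ∃ k, C k = p
    · obtain ⟨k, rfl⟩ := hp
      rw [sum_eq_single k (fun l _ hl => if_neg fun h => hl (hCinj h)) (by simp), if_pos rfl]
      exact_mod_cast (hz k).trans (hxl _)
    · push Not at hp
      rw [sum_eq_zero fun k _ => if_neg (hp k)]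
      exact Nat.zero_le _
  · intro p hp hp0
    obtain ⟨k, -, hk⟩ := Multiset.mem_sum.1 hp
    obtain rfl := Multiset.eq_of_mem_replicate hk
    refine hC.ne_zero k ?_
    ext j
    simp [hf, hp0]
  · intro j
    have h := congrFun hAz j
    rw [Pi.smul_apply, smul_eq_mul] at h
    rw [← h, ← Multiset.coe_mapAddMonoidHom, map_sum, ← Multiset.coe_sumAddMonoidHom, map_sum,
      Finset.sum_apply, Nat.cast_sum, mulVec, dotProduct]
    refine sum_congr rfl fun k _ => ?_
    simp [A, columnMatrix, mul_comm]

lemma span_boxPoint_eq_top (d : ℕ) {Δ : ℕ} (hΔ : 1 ≤ Δ) :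
    Submodule.span ℚ (Set.range fun (p : Fin d → Fin (Δ + 1)) k => (boxPoint p k : ℚ)) = ⊤ := by
  obtain ⟨C, hC⟩ := exists_columnMatrix_eq_one d hΔ
  rw [eq_top_iff, ← (Pi.basisFun ℚ (Fin d)).span_eq]
  refine Submodule.span_mono ?_
  rintro _ ⟨k, rfl⟩
  refine ⟨C k, ?_⟩
  ext j
  have : (boxPoint (C k) j : ℤ) = (1 : Matrix (Fin d) (Fin d) ℤ) j k := by rw [← hC]; rfl
  rw [Pi.basisFun_apply, Pi.single_apply]
  rw [one_apply] at this
  have h2 : (boxPoint (C k) j) = if j = k then 1 else 0 := by exact_mod_cast this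
  simp [h2]

lemma exists_submultisets_of_ne_zero {ι : Type*} {d Δ : ℕ} (hd : 1 ≤ d) (hΔ : 1 ≤ Δ)
    (T : ι → Multiset (Fin d → Fin (Δ + 1))) (b : Fin d → ℕ) (h0 : b ≠ 0)
    (hT : ∀ i, ((T i).map boxPoint).sum = b) :
    ∃ (S : ι → Multiset (Fin d → Fin (Δ + 1))) (c : Fin d → ℕ), ∀ i, S i ≠ 0 ∧ S i ≤ T i ∧
      Multiset.card (S i) ≤ cardBound d Δ ∧ ((S i).map boxPoint).sum = c := by
  classical
  set D := d.factorial * Δ ^ d with hD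
  have hD1 : 1 ≤ D := Nat.mul_pos (Nat.factorial_pos d) (pow_pos hΔ d)
  set R := d.factorial * (D ^ 2) ^ d with hR
  let κ := {C : Fin d → Fin d → Fin (Δ + 1) // (columnMatrix C).det ≠ 0 ∧
    ∀ k, 0 ≤ (fun j => (scaledInverse (columnMatrix C) k j : ℚ)) ⬝ᵥ fun j => (b j : ℚ)} × Fin d
  have hκ : Fintype.card κ ≤ ((Δ + 1) ^ d) ^ d * d := by
    rw [Fintype.card_prod, Fintype.card_fin]
    refine Nat.mul_le_mul_right _ ((Fintype.card_subtype_le _).trans_eq ?_)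
    simp
  -- The standard orthant is among the cones and supplies the unit functionals.
  obtain ⟨C₁, hC₁⟩ := exists_columnMatrix_eq_one d hΔ
  have hC₁' : ∀ k, scaledInverse (columnMatrix C₁) k = Pi.single k 1 := by
    intro k
    ext j
    simp [hC₁, scaledInverse, one_apply, Pi.single_apply, eq_comm]
  have hC₁mem : (columnMatrix C₁).det ≠ 0 ∧ ∀ k, 0 ≤
      (fun j => (scaledInverse (columnMatrix C₁) k j : ℚ)) ⬝ᵥ fun j => (b j : ℚ) := by
    refine ⟨by simp [hC₁], fun k => ?_⟩
    rw [hC₁']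
    simp [dotProduct, Pi.single_apply]
  obtain ⟨r, μ, hμ, hr0, hrnn, hrR, hr1, hr2, hsum⟩ := exists_int_vector_le (E := D ^ 2)
    (Nat.one_le_pow _ _ hD1) (fun c : κ => scaledInverse (columnMatrix c.1.1) c.2)
    (fun c k => abs_scaledInverse_le hΔ _ (abs_columnMatrix_le _) _ _)
    (fun k => ⟨(⟨C₁, hC₁mem⟩, k), hC₁' k⟩) (fun j => (b j : ℚ))
    (by
      intro h
      refine h0 (funext fun j => ?_)
      exact Nat.cast_eq_zero.1 (congrFun h j))
    (fun c => c.1.2.2 c.2)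
  have hrsum : ∑ k, r k ≤ d * R := by
    refine (sum_le_sum fun k _ => hrR k).trans_eq ?_
    simp [hR]
  have hcard : Fintype.card (Fin d → Fin (Δ + 1)) = (Δ + 1) ^ d := by simp
  -- Large μ: every S i sums to D! r. Small μ: b is small, and dropping zero vectors bounds the
  -- cardinality by its coordinate sum.
  rcases le_or_gt ((D.factorial : ℚ) * Fintype.card (Fin d → Fin (Δ + 1))) μ with hlarge | hsmall
  · choose S hST hS0 hSsum using fun i => exists_submultiset_sum_eq (M := D.factorial) (T i) b h0
      (hT i) (fun C hC => by
        rw [← Int.natAbs_dvd, Int.natCast_dvd_natCast]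
        refine Nat.dvd_factorial (Int.natAbs_pos.2 hC) ?_
        have := abs_det_le (columnMatrix C) (abs_columnMatrix_le C)
        rw [Int.abs_eq_natAbs] at this
        exact_mod_cast this)
      (span_boxPoint_eq_top d hΔ) r hlarge
      (fun C hC hCb k => ⟨hr1 (⟨C, hC, hCb⟩, k), hr2 (⟨C, hC, hCb⟩, k)⟩)
    refine ⟨S, fun k => D.factorial * (r k).toNat, fun i => ⟨?_, hST i, ?_, ?_⟩⟩
    · intro h
      refine hr0 (funext fun k => ?_)
      have := hSsum i k
      rw [h] at this
      simp only [Multiset.map_zero, Multiset.sum_zero, Pi.zero_apply, Nat.cast_zero] at this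
      exact (mul_eq_zero.1 this.symm).resolve_left (by exact_mod_cast D.factorial_ne_zero)
    · have h1 := card_le_sum_coordinates ((S i).map boxPoint) (by
        intro t ht
        obtain ⟨p, hp, rfl⟩ := Multiset.mem_map.1 ht
        exact hS0 i p hp)
      rw [Multiset.card_map] at h1
      have h2 : ∑ k, ((S i).map boxPoint).sum k ≤ D.factorial * (d * R) := by
        zify
        simp only [hSsum]
        rw [← mul_sum]
        exact mul_le_mul_of_nonneg_left hrsum (Nat.cast_nonneg _)
      refine (h1.trans h2).trans ?_
      unfold cardBound
      refine Nat.mul_le_mul_right _ ?_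
      rw [mul_left_comm]
      exact Nat.le_mul_of_pos_right _ (by positivity)
    · ext k
      zify
      rw [hSsum, Int.toNat_of_nonneg (hrnn k)]
  · have hbsum : ∑ k, b k ≤ cardBound d Δ := by
      have h1 : (∑ k, (b k : ℚ)) ≤ (((Δ + 1) ^ d) ^ d * d : ℕ) *
          ((D.factorial * (Δ + 1) ^ d : ℕ) * (d * R : ℕ)) := by
        refine hsum.trans ?_
        have h2 : (∑ k, (r k : ℚ)) ≤ (d * R : ℕ) := by exact_mod_cast hrsum
        have h3 : (0 : ℚ) ≤ ∑ k, (r k : ℚ) := sum_nonneg fun k _ => by exact_mod_cast hrnn k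
        have h4 : μ ≤ (D.factorial * (Δ + 1) ^ d : ℕ) := by
          rw [Nat.cast_mul, ← hcard]
          exact hsmall.le
        gcongr
      rw [← mul_assoc] at h1
      exact_mod_cast h1
    refine ⟨fun i => (T i).filter fun p => boxPoint p ≠ 0, b, fun i => ?_⟩
    have hfilter : (((T i).filter fun p => boxPoint p ≠ 0).map boxPoint).sum = b := by
      rw [← hT i]
      conv_rhs => rw [← Multiset.filter_add_not (fun p => boxPoint p ≠ 0) (T i)]
      rw [Multiset.map_add, Multiset.sum_add, eq_comm, add_eq_left]
      refine Multiset.sum_eq_zero fun t ht => ?_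
      obtain ⟨p, hp, rfl⟩ := Multiset.mem_map.1 ht
      simpa using (Multiset.mem_filter.1 hp).2
    refine ⟨?_, Multiset.filter_le _ _, ?_, hfilter⟩
    · intro h
      refine h0 ?_
      rw [← hfilter, show (T i).filter (fun p => boxPoint p ≠ 0) = 0 from h]
      simp
    · have h1 := card_le_sum_coordinates (((T i).filter fun p => boxPoint p ≠ 0).map boxPoint) (by
        intro t ht
        obtain ⟨p, hp, rfl⟩ := Multiset.mem_map.1 ht
        exact (Multiset.mem_filter.1 hp).2)
      rw [Multiset.card_map, hfilter] at h1
      exact h1.trans hbsum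

end Box

/-! ### Estimating the bound -/

section Arithmetic

lemma le_two_pow_pred {d : ℕ} (hd : 1 ≤ d) : d ≤ 2 ^ (d - 1) := by
  have := Nat.lt_two_pow_self (n := d - 1)
  omega

lemma factorial_mul_pow_le {d Δ : ℕ} (hd : 1 ≤ d) (hΔ : 2 ≤ Δ) :
    d.factorial * Δ ^ d ≤ Δ ^ (d ^ 2) := by
  have h : d.factorial ≤ Δ ^ ((d - 1) * d) := by
    calc d.factorial ≤ d ^ d := Nat.factorial_le_pow d
      _ ≤ (2 ^ (d - 1)) ^ d := Nat.pow_le_pow_left (le_two_pow_pred hd) d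
      _ = 2 ^ ((d - 1) * d) := by rw [pow_mul]
      _ ≤ _ := Nat.pow_le_pow_left hΔ _
  calc _ ≤ Δ ^ ((d - 1) * d) * Δ ^ d := Nat.mul_le_mul_right _ h
    _ = Δ ^ (d ^ 2) := by
      rw [← pow_add]
      congr 1
      obtain ⟨e, rfl⟩ := Nat.exists_eq_add_of_le' hd
      rw [Nat.add_sub_cancel]
      ring

lemma cardBound_le {d Δ : ℕ} (hd : 1 ≤ d) (hΔ : 2 ≤ Δ) :
    cardBound d Δ ≤ (d * Δ) ^ (10 * (d * Δ ^ (d ^ 2))) := by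
  set q := d * Δ with hq
  have hq1 : 1 ≤ q := Nat.mul_pos hd (by omega)
  have hdq : d ≤ q := Nat.le_mul_of_pos_right _ (by omega)
  have hΔq : Δ + 1 ≤ q ^ 2 := by
    have : Δ ≤ q := Nat.le_mul_of_pos_left _ hd
    nlinarith
  have hfac : d.factorial ≤ q ^ d :=
    (Nat.factorial_le_pow d).trans (Nat.pow_le_pow_left hdq d)
  have hD : d.factorial * Δ ^ d ≤ q ^ d := by
    rw [hq, mul_pow]
    exact Nat.mul_le_mul_right _ (Nat.factorial_le_pow d)
  have hM : (d.factorial * Δ ^ d).factorial ≤ q ^ (d * Δ ^ (d ^ 2)) := by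
    calc _ ≤ (d.factorial * Δ ^ d) ^ (d.factorial * Δ ^ d) := Nat.factorial_le_pow _
      _ ≤ (q ^ d) ^ (d.factorial * Δ ^ d) := Nat.pow_le_pow_left hD _
      _ ≤ (q ^ d) ^ (Δ ^ (d ^ 2)) :=
        Nat.pow_le_pow_right (Nat.pow_pos hq1) (factorial_mul_pow_le hd hΔ)
      _ = _ := by rw [pow_mul]
  have hlin : d ^ 2 ≤ d * Δ ^ (d ^ 2) := by
    refine (sq d).trans_le (Nat.mul_le_mul_left _ ?_)
    calc d ≤ d ^ 2 := Nat.le_self_pow two_ne_zero d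
      _ ≤ 2 ^ (d ^ 2) := Nat.lt_two_pow_self.le
      _ ≤ Δ ^ (d ^ 2) := Nat.pow_le_pow_left hΔ _
  unfold cardBound
  calc _ ≤ ((q ^ 2) ^ d) ^ d * q * (q ^ (d * Δ ^ (d ^ 2)) * (q ^ 2) ^ d) *
        (q * (q ^ d * ((q ^ d) ^ 2) ^ d)) := by gcongr
    _ = q ^ (4 * d ^ 2 + 3 * d + 2 + d * Δ ^ (d ^ 2)) := by ring
    _ ≤ _ := by
      -- The constant 10 is 4 + 3 + 2 + 1, as 1 and d are at most d², and d² ≤ d Δ^(d²).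
      refine Nat.pow_le_pow_right hq1 ?_
      have : 1 ≤ d ^ 2 := Nat.one_le_pow _ _ hd
      have : d ≤ d ^ 2 := Nat.le_self_pow two_ne_zero d
      omega

end Arithmetic

theorem lemma2 :
    ∃ K : ℕ, ∀ (d Δ n : ℕ), 1 ≤ d → 2 ≤ Δ →
      ∀ T : Fin n → Multiset (Fin d → ℕ),
        (∀ i, T i ≠ 0) →
        (∀ i, ∀ t ∈ T i, ∀ k, t k ≤ Δ) →
        (∀ i j, (T i).sum = (T j).sum) →
        ∃ S : Fin n → Multiset (Fin d → ℕ),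
          (∀ i, S i ≠ 0 ∧ S i ≤ T i ∧
            Multiset.card (S i) ≤ (d * Δ) ^ (K * (d * Δ ^ (d ^ 2)))) ∧
          ∀ i j, (S i).sum = (S j).sum := by
  refine ⟨10, fun d Δ n hd hΔ T hT0 hTΔ hTsum => ?_⟩
  by_cases hzero : ∀ i, (T i).sum = 0
  · choose t ht using fun i => Multiset.exists_mem_of_ne_zero (hT0 i)
    refine ⟨fun i => {t i}, fun i => ⟨Multiset.singleton_ne_zero _,
      Multiset.singleton_le.2 (ht i), ?_⟩, fun i j => ?_⟩
    · rw [Multiset.card_singleton]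
      exact Nat.one_le_pow _ _ (Nat.mul_pos hd (by omega))
    · have h : ∀ i, t i = 0 := fun i =>
        Multiset.sum_eq_zero_iff.1 (hzero i) _ (ht i)
      simp [h]
  · push Not at hzero
    obtain ⟨i₀, hi₀⟩ := hzero
    -- Reduction mod Δ + 1 changes nothing, since all entries are at most Δ.
    let T' : Fin n → Multiset (Fin d → Fin (Δ + 1)) := fun i =>
      (T i).map fun t k => Fin.ofNat (Δ + 1) (t k)
    have hT' : ∀ i, (T' i).map boxPoint = T i := by
      intro i
      rw [Multiset.map_map]
      conv_rhs => rw [← Multiset.map_id (T i)]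
      refine Multiset.map_congr rfl fun t ht => ?_
      ext k
      exact Nat.mod_eq_of_lt (Nat.lt_succ_of_le (hTΔ i t ht k))
    obtain ⟨S, c, hS⟩ := exists_submultisets_of_ne_zero hd (by omega : 1 ≤ Δ) T' (T i₀).sum hi₀
      fun i => by rw [hT', hTsum i i₀]
    refine ⟨fun i => (S i).map boxPoint, fun i => ⟨?_, ?_, ?_⟩, fun i j => ?_⟩
    · simpa using (hS i).1
    · rw [← hT' i]
      exact Multiset.map_le_map (hS i).2.1
    · rw [Multiset.card_map]
      exact (hS i).2.2.1.trans (cardBound_le hd hΔ)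
    · rw [(hS i).2.2.2, (hS j).2.2.2]
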